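/- Let $R$ be a commutative ring with identity and let $C$ be a semidualizing $R$-module, i.e. $C$ has a projective resolution by finitely generated projective modules, the homothety map $R\to\operatorname{Hom}_R(C,C)$ is an isomorphism, and $\operatorname{Ext}^n_R(C,C)=0$ for all $n\ge 1$. Let $\mathrm{Ch}(R)$ be the abelian category of ($\mathbb Z$-indexed) complexes of $R$-modules. For a class $\mathcal X$ of $R$-modules, closed under isomorphism, let $\widetilde{\mathcal X}$ be the class of exact complexes all of whose cycle modules lie in $\mathcal X$. Call the complexes in $\widetilde{\mathcal X}$ projective, $C$-projective or $C$-flat when $\mathcal X$ consists, respectively, of the projective modules, of the modules isomorphic to $C\otimes_R P$ with $P$ projective, or of the modules isomorphic to $C\otimes_R F$ with $F$ flat. A complex $X$ is called $D_C$-projective if there is an exact sequence in $\mathrm{Ch}(R)$ $$\cdots\to P_1\to P_0\xrightarrow{f_0}Q_{-1}\to Q_{-2}\to\cdots$$ with all $P_i$ projective complexes and all $Q_i$ $C$-projective complexes, which remains exact after applying $\operatorname{Hom}_{\mathrm{Ch}(R)}(-,H)$ for every $C$-flat complex $H$, and such that $X\cong\operatorname{Im} f_0$. Then the class of $D_C$-projective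 complexes is projectively resolving: it contains all projective objects of $\mathrm{Ch}(R)$, and for every short exact sequence $0\to X'\to X\to X''\to 0$ in $\mathrm{Ch}(R)$ with $X''$ $D_C$-projective, $X'$ is $D_C$-projective if and only if $X$ is $D_C$-projective. Moreover, it contains all projective complexes in the above sense. -/

import Mathlib

open CategoryTheory
open scoped TensorProduct

universe v w u

section AbelianCategories

variable {A : Type w} [Category.{v} A] [Abelian A]

/-- A class `𝓧` of objects of an abelian category is projectively resolving if it contains all
projective objects and, for every short exact sequence `0 ⟶ X' ⟶ X ⟶ X'' ⟶ 0` with `X''` in `𝓧`,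
`X` is in `𝓧` if and only if `X'` is. -/
def IsProjectivelyResolving (𝓧 : ObjectProperty A) : Prop :=
  (∀ P : A, Projective P → 𝓧 P) ∧
    ∀ S : ShortComplex A, S.ShortExact → 𝓧 S.X₃ → (𝓧 S.X₂ ↔ 𝓧 S.X₁)

/-- The sequence `⋯ ⟶ L₁ ⟶ L₀ ⟶ L₋₁ ⟶ ⋯` is `Hom(-, 𝓑)`-exact: for every `B` in `𝓑` the sequence
of groups `⋯ ⟶ Hom(L₋₁, B) ⟶ Hom(L₀, B) ⟶ Hom(L₁, B) ⟶ ⋯` is exact. -/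
def IsHomExact (𝓑 : ObjectProperty A) (L : ChainComplex A ℤ) : Prop :=
  ∀ B : A, 𝓑 B → ∀ i : ℤ,
    Function.Exact (fun g : L.X (i - 1) ⟶ B => L.d i (i - 1) ≫ g)
      (fun g : L.X i ⟶ B => L.d (i + 1) i ≫ g)

end AbelianCategories

section Modules

variable (R : Type u) [CommRing R]

/-- The class `𝓟(R)` of projective `R`-modules. -/
def projectiveModules : ObjectProperty (ModuleCat.{u} R) :=
  fun M => Module.Projective R M

variable (C : Type u) [AddCommGroup C] [Module R C]

/-- `C` is a semidualizing `R`-module. -/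
structure IsSemidualizing : Prop where
  /-- `C` has a projective resolution by finitely generated projective modules. -/
  exists_finite_resolution : ∃ P : ProjectiveResolution (ModuleCat.of R C),
    ∀ n, Module.Finite R (P.complex.X n)
  /-- The homothety map `R ⟶ Hom_R(C, C)` is an isomorphism. -/
  homothety_bijective : Function.Bijective (LinearMap.lsmul R C)
  /-- `Ext_R^n(C, C) = 0` for all `n ≥ 1`. -/
  ext_subsingleton : ∀ n : ℕ, 1 ≤ n →
    Subsingleton (Abelian.Ext.{u} (ModuleCat.of R C) (ModuleCat.of R C) n)

/-- The class `𝓟_C(R)` of modules isomorphic to `C ⊗ P` with `P` projective. -/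
def cProjectiveModules : ObjectProperty (ModuleCat.{u} R) :=
  fun M => ∃ P : ModuleCat.{u} R, Module.Projective R P ∧ Nonempty (M ≃ₗ[R] C ⊗[R] P)

/-- The class `𝓕_C(R)` of modules isomorphic to `C ⊗ F` with `F` flat. -/
def cFlatModules : ObjectProperty (ModuleCat.{u} R) :=
  fun M => ∃ F : ModuleCat.{u} R, Module.Flat R F ∧ Nonempty (M ≃ₗ[R] C ⊗[R] F)

variable {R} in
/-- The class of `𝓧`-complexes: exact complexes of `R`-modules all of whose cycle modules lie
in `𝓧`. -/
def complexesOf (𝓧 : ObjectProperty (ModuleCat.{u} R)) :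
    ObjectProperty (ChainComplex (ModuleCat.{u} R) ℤ) :=
  fun X => X.Acyclic ∧ ∀ i : ℤ, 𝓧 (X.cycles i)

/-- The class of `D_C`-projective complexes: complexes isomorphic to the image of `E₀ ⟶ E₋₁` for
some exact sequence of complexes `⋯ ⟶ E₁ ⟶ E₀ ⟶ E₋₁ ⟶ ⋯`, with `Eᵢ` a projective complex for
`i ≥ 0` and a `C`-projective complex for `i < 0`, that is `Hom(-, H)`-exact for all `C`-flat
complexes `H`. -/
def dcProjectiveComplexes : ObjectProperty (ChainComplex (ModuleCat.{u} R) ℤ) :=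
  fun X => ∃ E : ChainComplex (ChainComplex (ModuleCat.{u} R) ℤ) ℤ,
    E.Acyclic ∧
    IsHomExact (complexesOf (cFlatModules R C)) E ∧
    (∀ i : ℤ, 0 ≤ i → complexesOf (projectiveModules R) (E.X i)) ∧
    (∀ i : ℤ, i < 0 → complexesOf (cProjectiveModules R C) (E.X i)) ∧
    Nonempty (X ≅ Limits.image (E.d 0 (-1)))

end Modules

/-! Call an object properly coresolved if it starts an exact sequence `0 ⟶ X ⟶ Q₋₁ ⟶ Q₋₂ ⟶ ⋯`
of `C`-projective objects such that `X` and all cokernels `W` satisfy `Ext^n(W, H) = 0` for `n ≥ 1`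
and `H` `C`-flat. Splicing with a projective resolution shows that this is the same as being
`D_C`-projective. The horseshoe lemma gives closure under extensions, and for a monomorphism
`X' ⟶ X` followed by a proper embedding `X ⟶ Q`, the short exact sequence
`0 ⟶ X / X' ⟶ Q / X' ⟶ Q / X ⟶ 0` gives closure under kernels of epimorphisms.

Projective complexes are sums of disks on projective modules, so it remains to coresolve a
projective module `Q` properly. Applying `Hom(-, C) ⊗ Q` to a resolution of `C` by finitely
generated projectives, with syzygies `K`, gives an exact sequence that starts with
`Hom(C, C) ⊗ Q ≅ Q`, and the evaluation maps `K ⊗ F ⟶ Hom(Hom(K, C), C ⊗ F)` are bijective for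
flat `F`, by induction on the syzygy, which yields the required vanishing of `Ext`. -/

section SnakeLemma

open Limits

variable {A : Type w} [Category.{v} A] [Abelian A]

lemma shortExact_cokernel {S T : ShortComplex A} (hS : S.ShortExact) (hT : T.ShortExact)
    (φ : S ⟶ T) [Mono φ.τ₃] : (cokernel φ).ShortExact := by
  let I : ShortComplex.SnakeInput A :=
    { L₀ := kernel φ
      L₁ := S
      L₂ := T
      L₃ := cokernel φ
      v₀₁ := kernel.ι φ
      v₁₂ := φ
      v₂₃ := cokernel.π φ
      h₀ := kernelIsKernel φ
      h₃ := cokernelIsCokernel φ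
      L₁_exact := hS.exact
      epi_L₁_g := hS.epi_g
      L₂_exact := hT.exact
      mono_L₂_f := hT.mono_f }
  have : Epi I.L₂.g := hT.epi_g
  have hI : IsZero I.L₀.X₃ :=
    (isZero_kernel_of_mono φ.τ₃).of_iso (PreservesKernel.iso ShortComplex.π₃ φ)
  exact
    { exact := I.L₃_exact
      mono_f := I.L₂'_exact.mono_g (hI.eq_of_src _ _)
      epi_g := I.epi_L₃_g }

/-- The morphism from a short exact sequence `S` to the split sequence `0 ⟶ Q ⟶ Q ⊞ Q' ⟶ Q' ⟶ 0`
used in the horseshoe lemma. -/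
noncomputable def horseshoeMap (S : ShortComplex A) {Q Q' : A} (h : S.X₂ ⟶ Q) (f : S.X₃ ⟶ Q') :
    S ⟶ ShortComplex.mk (biprod.inl : Q ⟶ Q ⊞ Q') biprod.snd (by simp) where
  τ₁ := S.f ≫ h
  τ₂ := biprod.lift h (S.g ≫ f)
  τ₃ := f

lemma shortExact_cokernel_comp {X Y Z : A} (f : X ⟶ Y) (g : Y ⟶ Z) [Mono g] :
    (ShortComplex.mk (cokernel.map f (f ≫ g) (𝟙 _) g (by simp))
      (cokernel.map (f ≫ g) g f (𝟙 _) (by simp)) (by ext; simp)).ShortExact := by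
  let I := kernelCokernelCompSequence.snakeInput f g
  have hI : IsZero I.L₀.X₃ := isZero_kernel_of_mono g
  exact
    { exact := I.L₃_exact
      mono_f := I.L₂'_exact.mono_g (hI.eq_of_src _ _)
      epi_g := inferInstanceAs (Epi (cokernel.map (f ≫ g) g f (𝟙 _) (by simp))) }

end SnakeLemma

section ExtVanishing

open Abelian

variable {A : Type w} [Category.{v} A] [Abelian A] [HasExt.{u} A] {S : ShortComplex A} {X Y : A}
  {n : ℕ}

lemma subsingleton_ext_X₂ (hS : S.ShortExact) (h₁ : Subsingleton (Ext S.X₁ Y n))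
    (h₃ : Subsingleton (Ext S.X₃ Y n)) : Subsingleton (Ext S.X₂ Y n) := by
  refine subsingleton_of_forall_eq 0 fun e => ?_
  obtain ⟨x, rfl⟩ := Ext.contravariant_sequence_exact₂ hS Y e (Subsingleton.elim _ _)
  rw [Subsingleton.elim x 0, Ext.comp_zero]

lemma subsingleton_ext_X₁ (hS : S.ShortExact) (h₂ : Subsingleton (Ext S.X₂ Y n))
    (h₃ : Subsingleton (Ext S.X₃ Y (n + 1))) : Subsingleton (Ext S.X₁ Y n) := by
  refine subsingleton_of_forall_eq 0 fun e => ?_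
  obtain ⟨x, rfl⟩ := Ext.contravariant_sequence_exact₁ hS Y e (add_comm 1 n)
    (Subsingleton.elim _ _)
  rw [Subsingleton.elim x 0, Ext.comp_zero]

lemma subsingleton_ext_X₃ (hS : S.ShortExact) (h₁ : Subsingleton (Ext S.X₁ Y n))
    (h₂ : Subsingleton (Ext S.X₂ Y (n + 1))) : Subsingleton (Ext S.X₃ Y (n + 1)) := by
  refine subsingleton_of_forall_eq 0 fun e => ?_
  obtain ⟨x, rfl⟩ := Ext.contravariant_sequence_exact₃ hS Y e (Subsingleton.elim _ _)
    (add_comm 1 n)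
  rw [Subsingleton.elim x 0, Ext.comp_zero]

lemma comp_left_surjective_of_ext (hS : S.ShortExact) (h₃ : Subsingleton (Ext S.X₃ Y 1)) :
    Function.Surjective fun g : S.X₂ ⟶ Y => S.f ≫ g := by
  intro f
  obtain ⟨x, hx⟩ := Ext.contravariant_sequence_exact₁ hS Y (Ext.mk₀ f) (add_zero 1)
    (Subsingleton.elim _ _)
  obtain ⟨g, rfl⟩ := (Ext.mk₀_bijective _ _).2 x
  exact ⟨g, (Ext.mk₀_bijective _ _).1 (by rw [← hx, Ext.mk₀_comp_mk₀])⟩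

lemma subsingleton_ext_one_X₃ (hS : S.ShortExact)
    (h : Function.Surjective fun g : S.X₂ ⟶ Y => S.f ≫ g)
    (h₂ : Subsingleton (Ext S.X₂ Y 1)) : Subsingleton (Ext S.X₃ Y 1) := by
  refine subsingleton_of_forall_eq 0 fun e => ?_
  obtain ⟨x, rfl⟩ := Ext.contravariant_sequence_exact₃ hS Y e (Subsingleton.elim _ _)
    (add_zero 1)
  obtain ⟨f, rfl⟩ := (Ext.mk₀_bijective _ _).2 x
  obtain ⟨g, rfl⟩ := h f
  rw [← Ext.mk₀_comp_mk₀, ← Ext.comp_assoc (a₁₂ := 1) (a₂₃ := 0) (h := by simp) (h₁₂ := by simp)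
    (h₂₃ := by simp), hS.extClass_comp, Ext.zero_comp]

lemma subsingleton_ext_to_X₂ (hS : S.ShortExact) (h₁ : Subsingleton (Ext X S.X₁ n))
    (h₃ : Subsingleton (Ext X S.X₃ n)) : Subsingleton (Ext X S.X₂ n) := by
  refine subsingleton_of_forall_eq 0 fun e => ?_
  obtain ⟨x, rfl⟩ := Ext.covariant_sequence_exact₂ X hS e (Subsingleton.elim _ _)
  rw [Subsingleton.elim x 0, Ext.zero_comp]

lemma subsingleton_ext_of_retract {X' : A} (h : Retract X' X) (hX : Subsingleton (Ext X Y n)) :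
    Subsingleton (Ext X' Y n) := by
  refine subsingleton_of_forall_eq 0 fun e => ?_
  rw [← Ext.mk₀_id_comp e, ← h.retract, ← Ext.mk₀_comp_mk₀_assoc,
    Subsingleton.elim ((Ext.mk₀ h.r).comp e (zero_add n)) 0, Ext.comp_zero]

/-- The class of objects `X` with `Ext^n(X, H) = 0` for all `n ≥ 1` and all `H` in `𝓗`. -/
def extOrthogonal (𝓗 : ObjectProperty A) : ObjectProperty A :=
  fun X => ∀ H, 𝓗 H → ∀ n : ℕ, Subsingleton (Ext X H (n + 1))

variable {𝓗 : ObjectProperty A}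

instance : (extOrthogonal 𝓗).IsStableUnderRetracts where
  of_retract h hX H hH n := subsingleton_ext_of_retract h (hX H hH n)

instance : (extOrthogonal 𝓗).IsClosedUnderExtensions where
  prop_X₂_of_shortExact hS h₁ h₃ H hH n := subsingleton_ext_X₂ hS (h₁ H hH n) (h₃ H hH n)

lemma isProjective_le_extOrthogonal : isProjective A ≤ extOrthogonal 𝓗 :=
  fun P _ H _ n => Ext.subsingleton_of_projective P H n

lemma extOrthogonal_X₁ (hS : S.ShortExact) (h₂ : extOrthogonal 𝓗 S.X₂)
    (h₃ : extOrthogonal 𝓗 S.X₃) : extOrthogonal 𝓗 S.X₁ :=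
  fun H hH n => subsingleton_ext_X₁ hS (h₂ H hH n) (h₃ H hH (n + 1))

lemma extOrthogonal_X₃ (hS : S.ShortExact) (h₁ : extOrthogonal 𝓗 S.X₁)
    (h₂ : extOrthogonal 𝓗 S.X₂)
    (h : ∀ H, 𝓗 H → Function.Surjective fun g : S.X₂ ⟶ H => S.f ≫ g) :
    extOrthogonal 𝓗 S.X₃
  | H, hH, 0 => subsingleton_ext_one_X₃ hS (h H hH) (h₂ H hH 0)
  | H, hH, n + 1 => subsingleton_ext_X₃ hS (h₁ H hH n) (h₂ H hH (n + 1))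

lemma extOrthogonal_of_syzygies {J : Type*} (next : J → J) (S : J → ShortComplex A)
    (hS : ∀ j, (S j).ShortExact) (e : ∀ j, (S j).X₁ ≅ (S (next j)).X₃)
    (h₂ : ∀ j, extOrthogonal 𝓗 (S j).X₂)
    (h : ∀ j H, 𝓗 H → Function.Surjective fun g : (S j).X₂ ⟶ H => (S j).f ≫ g) (j : J) :
    extOrthogonal 𝓗 (S j).X₃ := by
  intro H hH n
  induction n generalizing j with
  | zero => exact subsingleton_ext_one_X₃ (hS j) (h j H hH) (h₂ j H hH 0)
  | succ n ih =>
    exact subsingleton_ext_X₃ (hS j) (subsingleton_ext_of_retract (e j).retract (ih (next j)))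
      (h₂ j H hH (n + 1))

end ExtVanishing

section ProperCoresolutions

open Limits

variable {A : Type w} [Category.{v} A] [Abelian A]

/-- `X` is a syzygy of `Y` relative to `𝓔`: there is a short exact sequence
`0 ⟶ X ⟶ E ⟶ Y ⟶ 0` with `E` in `𝓔`. -/
def IsSyzygy (𝓔 : ObjectProperty A) (X Y : A) : Prop :=
  ∃ (E : A) (a : X ⟶ E) (b : E ⟶ Y) (w : a ≫ b = 0),
    (ShortComplex.mk a b w).ShortExact ∧ 𝓔 E

lemma IsSyzygy.of_iso {𝓔 : ObjectProperty A} {X X' Y Y' : A} (e : X ≅ X') (e' : Y ≅ Y')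
    (h : IsSyzygy 𝓔 X Y) : IsSyzygy 𝓔 X' Y' := by
  obtain ⟨E, a, b, w, hS, hE⟩ := h
  exact ⟨E, e.inv ≫ a, b ≫ e'.hom, by simp [reassoc_of% w],
    ShortComplex.shortExact_of_iso (ShortComplex.isoMk (S₁ := .mk a b w)
      e (Iso.refl _) e' (by simp) (by simp)) hS, hE⟩

lemma isSyzygy_cokernel {𝓔 : ObjectProperty A} {X E : A} (f : X ⟶ E) [Mono f] (hE : 𝓔 E) :
    IsSyzygy 𝓔 X (cokernel f) :=
  ⟨E, f, cokernel.π f, cokernel.condition f, { exact := ShortComplex.exact_cokernel f }, hE⟩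

lemma isSyzygy_kernel {𝓔 : ObjectProperty A} {E Y : A} (f : E ⟶ Y) [Epi f] (hE : 𝓔 E) :
    IsSyzygy 𝓔 (kernel f) Y :=
  ⟨E, kernel.ι f, f, kernel.condition f, { exact := ShortComplex.exact_kernel f }, hE⟩

variable [HasExt.{u} A] {𝓠 𝓗 : ObjectProperty A}

lemma extOrthogonal_of_isSyzygy {𝓔 : ObjectProperty A} (h𝓔 : 𝓔 ≤ extOrthogonal 𝓗) {X Y : A}
    (h : IsSyzygy 𝓔 X Y) (hY : extOrthogonal 𝓗 Y) : extOrthogonal 𝓗 X := by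
  obtain ⟨E, a, b, w, hS, hE⟩ := h
  exact extOrthogonal_X₁ hS (h𝓔 _ hE) hY

/-- The class of objects `X` for which there is an exact sequence
`0 ⟶ X ⟶ Q₋₁ ⟶ Q₋₂ ⟶ ⋯` with all `Qᵢ` in `𝓠` and all cokernels, as well as `X`, in
`extOrthogonal 𝓗`. It is encoded coinductively, by a class `𝓦` containing `X` each member of which
is a syzygy of another one. -/
def properlyCoresolved (𝓠 𝓗 : ObjectProperty A) : ObjectProperty A :=
  fun X => ∃ 𝓦 : ObjectProperty A, 𝓦 ≤ extOrthogonal 𝓗 ∧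
    (∀ W, 𝓦 W → ∃ W', 𝓦 W' ∧ IsSyzygy 𝓠 W W') ∧ 𝓦 X

lemma properlyCoresolved_le_extOrthogonal : properlyCoresolved 𝓠 𝓗 ≤ extOrthogonal 𝓗 :=
  fun _ ⟨_, h, _, hX⟩ => h _ hX

lemma exists_isSyzygy_of_properlyCoresolved {X : A} (hX : properlyCoresolved 𝓠 𝓗 X) :
    ∃ Y, properlyCoresolved 𝓠 𝓗 Y ∧ IsSyzygy 𝓠 X Y := by
  obtain ⟨𝓦, h𝓦, H, hX⟩ := hX
  obtain ⟨Y, hY, hXY⟩ := H X hX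
  exact ⟨Y, ⟨𝓦, h𝓦, H, hY⟩, hXY⟩

lemma properlyCoresolved_of_isSyzygy {X Y : A} (h : IsSyzygy 𝓠 X Y) (hX : extOrthogonal 𝓗 X)
    (hY : properlyCoresolved 𝓠 𝓗 Y) : properlyCoresolved 𝓠 𝓗 X := by
  refine ⟨fun W => W = X ∨ properlyCoresolved 𝓠 𝓗 W, ?_, ?_, .inl rfl⟩
  · rintro W (rfl | hW)
    · exact hX
    · exact properlyCoresolved_le_extOrthogonal _ hW
  · rintro W (rfl | hW)
    · exact ⟨Y, .inr hY, h⟩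
    · obtain ⟨W', hW', hWW'⟩ := exists_isSyzygy_of_properlyCoresolved hW
      exact ⟨W', .inr hW', hWW'⟩

instance : (properlyCoresolved 𝓠 𝓗).IsClosedUnderIsomorphisms where
  of_iso e hX := by
    obtain ⟨Z, hZ, hXZ⟩ := exists_isSyzygy_of_properlyCoresolved hX
    exact properlyCoresolved_of_isSyzygy (hXZ.of_iso e (Iso.refl Z))
      ((extOrthogonal 𝓗).prop_of_iso e (properlyCoresolved_le_extOrthogonal _ hX)) hZ

lemma exists_mono_of_properlyCoresolved {X : A} (hX : properlyCoresolved 𝓠 𝓗 X) :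
    ∃ (Q : A) (f : X ⟶ Q), Mono f ∧ 𝓠 Q ∧ properlyCoresolved 𝓠 𝓗 (cokernel f) := by
  obtain ⟨Y, hY, Q, f, g, w, hS, hQ⟩ := exists_isSyzygy_of_properlyCoresolved hX
  exact ⟨Q, f, hS.mono_f, hQ, (properlyCoresolved 𝓠 𝓗).prop_of_iso
    ((cokernelIsCokernel f).coconePointUniqueUpToIso hS.gIsCokernel).symm hY⟩

variable {S : ShortComplex A}

lemma properlyCoresolved_X₂ (h𝓠 : 𝓠 ≤ 𝓗) (hQ : ∀ Q Q', 𝓠 Q → 𝓠 Q' → 𝓠 (Q ⊞ Q'))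
    (hS : S.ShortExact) (h₁ : properlyCoresolved 𝓠 𝓗 S.X₁)
    (h₃ : properlyCoresolved 𝓠 𝓗 S.X₃) : properlyCoresolved 𝓠 𝓗 S.X₂ := by
  refine ⟨fun W => ∃ T : ShortComplex A, T.ShortExact ∧ properlyCoresolved 𝓠 𝓗 T.X₁ ∧
    properlyCoresolved 𝓠 𝓗 T.X₃ ∧ T.X₂ = W, ?_, ?_, ⟨S, hS, h₁, h₃, rfl⟩⟩
  · rintro _ ⟨T, hT, h₁, h₃, rfl⟩
    exact (extOrthogonal 𝓗).prop_X₂_of_shortExact hT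
      (properlyCoresolved_le_extOrthogonal _ h₁) (properlyCoresolved_le_extOrthogonal _ h₃)
  · rintro _ ⟨T, hT, h₁, h₃, rfl⟩
    obtain ⟨Q₁, f₁, _, hQ₁, hN₁⟩ := exists_mono_of_properlyCoresolved h₁
    obtain ⟨Q₃, f₃, _, hQ₃, hN₃⟩ := exists_mono_of_properlyCoresolved h₃
    obtain ⟨h, rfl⟩ := comp_left_surjective_of_ext hT
      (properlyCoresolved_le_extOrthogonal _ h₃ Q₁ (h𝓠 _ hQ₁) 0) f₁
    let φ := horseshoeMap T h f₃
    have : Mono φ.τ₁ := ‹Mono (T.f ≫ h)›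
    have : Mono φ.τ₃ := ‹Mono f₃›
    have : Mono T.f := hT.mono_f
    have hT' := (ShortComplex.Splitting.ofHasBinaryBiproduct Q₁ Q₃).shortExact
    have := hT'.mono_f
    have : Mono φ.τ₂ := ShortComplex.mono_τ₂_of_exact_of_mono φ hT.exact
    refine ⟨(cokernel φ).X₂, ⟨_, shortExact_cokernel hT hT' φ, ?_, ?_, rfl⟩,
      (isSyzygy_cokernel φ.τ₂ (hQ Q₁ Q₃ hQ₁ hQ₃)).of_iso (Iso.refl _)
        (PreservesCokernel.iso ShortComplex.π₂ φ).symm⟩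
    · exact ObjectProperty.prop_of_iso _ (PreservesCokernel.iso ShortComplex.π₁ φ).symm hN₁
    · exact ObjectProperty.prop_of_iso _ (PreservesCokernel.iso ShortComplex.π₃ φ).symm hN₃

lemma properlyCoresolved_X₁ (h𝓠 : 𝓠 ≤ 𝓗) (hQ : ∀ Q Q', 𝓠 Q → 𝓠 Q' → 𝓠 (Q ⊞ Q'))
    (hS : S.ShortExact) (h₂ : properlyCoresolved 𝓠 𝓗 S.X₂)
    (h₃ : properlyCoresolved 𝓠 𝓗 S.X₃) : properlyCoresolved 𝓠 𝓗 S.X₁ := by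
  have := hS.mono_f
  obtain ⟨Q, g, _, hQ', hN⟩ := exists_mono_of_properlyCoresolved h₂
  have hfg : properlyCoresolved 𝓠 𝓗 (cokernel (S.f ≫ g)) :=
    properlyCoresolved_X₂ h𝓠 hQ (shortExact_cokernel_comp S.f g)
      (ObjectProperty.prop_of_iso _
        ((cokernelIsCokernel S.f).coconePointUniqueUpToIso hS.gIsCokernel).symm h₃) hN
  exact properlyCoresolved_of_isSyzygy (isSyzygy_cokernel (S.f ≫ g) hQ')
    (extOrthogonal_X₁ hS (properlyCoresolved_le_extOrthogonal _ h₂)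
      (properlyCoresolved_le_extOrthogonal _ h₃)) hfg

end ProperCoresolutions

section CompleteResolutions

open Limits

variable {A : Type w} [Category.{v} A] [Abelian A]

lemma exact_epi_comp_comp_mono {S : ShortComplex A} (hS : S.Exact) {X Y : A} (p : X ⟶ S.X₁) [Epi p]
    (i : S.X₃ ⟶ Y) [Mono i] :
    (ShortComplex.mk (p ≫ S.f) (S.g ≫ i) (by simp)).Exact := by
  let T : ShortComplex A := .mk S.f (S.g ≫ i) (by simp)
  let φ : ShortComplex.mk (p ≫ S.f) (S.g ≫ i) (by simp) ⟶ T :=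
    { τ₁ := p, τ₂ := 𝟙 _, τ₃ := 𝟙 _ }
  let ψ : S ⟶ T := { τ₁ := 𝟙 _, τ₂ := 𝟙 _, τ₃ := i }
  have : Epi φ.τ₁ := ‹Epi p›
  have : Mono ψ.τ₃ := ‹Mono i›
  exact (ShortComplex.exact_iff_of_epi_of_isIso_of_mono φ).2
    ((ShortComplex.exact_iff_of_epi_of_isIso_of_mono ψ).1 hS)

lemma isHomExact_iff_exists_d_comp {𝓑 : ObjectProperty A} {E : ChainComplex A ℤ} :
    IsHomExact 𝓑 E ↔ ∀ B, 𝓑 B → ∀ (i : ℤ) (g : E.X (i + 1) ⟶ B),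
      E.d (i + 1 + 1) (i + 1) ≫ g = 0 → ∃ f, E.d (i + 1) i ≫ f = g := by
  refine ⟨fun h B hB i g hg => ?_, fun h B hB i g => ⟨fun hg => ?_, ?_⟩⟩
  · obtain ⟨j, hj⟩ : ∃ j, j = i + 1 - 1 := ⟨_, rfl⟩
    have := h B hB (i + 1) g
    rw [← hj] at this
    obtain rfl : j = i := by omega
    exact this.1 hg
  · obtain ⟨j, hj⟩ : ∃ j, j = i - 1 := ⟨_, rfl⟩
    rw [← hj]
    obtain rfl : i = j + 1 := by omega
    exact h B hB j g hg
  · rintro ⟨f, rfl⟩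
    simp

/-- A decomposition of a complex `E` into short exact sequences
`0 ⟶ Z (i + 1) ⟶ E.X i ⟶ Z i ⟶ 0`. -/
structure Splicing (E : ChainComplex A ℤ) where
  /-- The objects through which the differentials of `E` factor. -/
  Z : ℤ → A
  /-- The inclusion of `Z (i + 1)` as the kernel of the differential. -/
  ι (i : ℤ) : Z (i + 1) ⟶ E.X i
  /-- The projection onto `Z i` as the image of the differential. -/
  π (i : ℤ) : E.X i ⟶ Z i
  ι_π (i : ℤ) : ι i ≫ π i = 0
  shortExact (i : ℤ) : (ShortComplex.mk (ι i) (π i) (ι_π i)).ShortExact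
  d_eq (i : ℤ) : E.d (i + 1) i = π (i + 1) ≫ ι i

namespace Splicing

variable {E : ChainComplex A ℤ} (σ : Splicing E)

instance (i : ℤ) : Mono (σ.ι i) := (σ.shortExact i).mono_f

instance (i : ℤ) : Epi (σ.π i) := (σ.shortExact i).epi_g

include σ in
lemma acyclic : E.Acyclic := by
  intro i
  obtain ⟨i, rfl⟩ : ∃ j, i = j + 1 := ⟨i - 1, by omega⟩
  rw [E.exactAt_iff' (i + 1 + 1) (i + 1) i (by simp) (by simp)]
  simpa only [HomologicalComplex.sc', HomologicalComplex.shortComplexFunctor', σ.d_eq] using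
    exact_epi_comp_comp_mono (σ.shortExact (i + 1)).exact (σ.π (i + 1 + 1)) (σ.ι i)

lemma nonempty_iso_image {i j : ℤ} (hij : j + 1 = i) : Nonempty (σ.Z i ≅ image (E.d i j)) := by
  subst hij
  have := strongEpi_of_epi (σ.π (j + 1))
  exact ⟨image.isoStrongEpiMono (σ.π (j + 1)) (σ.ι j) (σ.d_eq j).symm⟩

lemma nonempty_iso_cycles (i : ℤ) : Nonempty (σ.Z (i + 1) ≅ E.cycles i) := by
  obtain ⟨i, rfl⟩ : ∃ j, i = j + 1 := ⟨i - 1, by omega⟩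
  exact ⟨(isKernelCompMono (σ.shortExact (i + 1)).fIsKernel (σ.ι i)
    (σ.d_eq i)).conePointUniqueUpToIso (E.cyclesIsKernel (i + 1) i (by simp))⟩

lemma d_comp_eq_zero_iff {i : ℤ} {B : A} (g : E.X i ⟶ B) :
    E.d (i + 1) i ≫ g = 0 ↔ ∃ f, σ.π i ≫ f = g := by
  refine ⟨fun hg => ?_, ?_⟩
  · have : σ.ι i ≫ g = 0 := by
      rw [← cancel_epi (σ.π (i + 1)), comp_zero, ← hg, σ.d_eq, Category.assoc]
    exact ⟨(σ.shortExact i).exact.desc g this, (σ.shortExact i).exact.g_desc g this⟩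
  · rintro ⟨f, rfl⟩
    simp [σ.d_eq, reassoc_of% σ.ι_π i]

lemma isHomExact_iff {𝓑 : ObjectProperty A} :
    IsHomExact 𝓑 E ↔
      ∀ i B, 𝓑 B → Function.Surjective fun g : E.X i ⟶ B => σ.ι i ≫ g := by
  rw [isHomExact_iff_exists_d_comp]
  refine ⟨fun h i B hB f => ?_, fun h B hB i g hg => ?_⟩
  · obtain ⟨g, hg⟩ := h B hB i (σ.π (i + 1) ≫ f) ((σ.d_comp_eq_zero_iff _).2 ⟨f, rfl⟩)
    exact ⟨g, by rwa [σ.d_eq, Category.assoc, cancel_epi] at hg⟩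
  · obtain ⟨f, rfl⟩ := (σ.d_comp_eq_zero_iff g).1 hg
    obtain ⟨g, rfl⟩ := h i B hB f
    exact ⟨g, by rw [σ.d_eq, Category.assoc]⟩

lemma extOrthogonal_Z [HasExt.{u} A] {𝓗 : ObjectProperty A} (hH : IsHomExact 𝓗 E)
    (hE : ∀ i, extOrthogonal 𝓗 (E.X i)) (i : ℤ) : extOrthogonal 𝓗 (σ.Z i) :=
  extOrthogonal_of_syzygies (· + 1) _ σ.shortExact (fun _ => Iso.refl _) hE
    (σ.isHomExact_iff.1 hH) i

end Splicing

lemma shortExact_opcycles {ι : Type*} {c : ComplexShape ι} (E : HomologicalComplex A c) {i j : ι}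
    (hij : c.Rel i j) (hE : E.ExactAt i) :
    (ShortComplex.mk (E.fromOpcycles i j) (E.pOpcycles j)
      (by simp [← cancel_epi (E.pOpcycles i)])).ShortExact where
  exact := by
    let φ : ShortComplex.mk (E.d i j) (E.pOpcycles j) (by simp) ⟶
        ShortComplex.mk (E.fromOpcycles i j) (E.pOpcycles j)
          (by simp [← cancel_epi (E.pOpcycles i)]) :=
      { τ₁ := E.pOpcycles i, τ₂ := 𝟙 _, τ₃ := 𝟙 _ }
    have : Epi φ.τ₁ := inferInstanceAs (Epi (E.pOpcycles i))
    exact (ShortComplex.exact_iff_of_epi_of_isIso_of_mono φ).1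
      (ShortComplex.exact_of_g_is_cokernel _ (E.opcyclesIsCokernel i j (c.prev_eq' hij)))
  mono_f := by
    obtain rfl := c.next_eq' hij
    exact ShortComplex.Exact.mono_fromOpcycles hE

/-- The decomposition of an acyclic complex given by its opcycles. -/
noncomputable def opcyclesSplicing {E : ChainComplex A ℤ} (hE : E.Acyclic) : Splicing E where
  Z i := E.opcycles i
  ι i := E.fromOpcycles (i + 1) i
  π i := E.pOpcycles i
  ι_π i := by simp [← cancel_epi (E.pOpcycles (i + 1))]
  shortExact i := shortExact_opcycles E (by simp) (hE (i + 1))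
  d_eq i := by simp

lemma exists_splicing {Z : ℤ → A} {𝓔 : ℤ → ObjectProperty A}
    (h : ∀ i, IsSyzygy (𝓔 i) (Z (i + 1)) (Z i)) :
    ∃ (E : ChainComplex A ℤ) (σ : Splicing E), σ.Z = Z ∧ ∀ i, 𝓔 i (E.X i) := by
  choose X a b w hS hX using h
  exact ⟨.of X (fun i => b (i + 1) ≫ a i) fun i => by simp [reassoc_of% w (i + 1)],
    { Z := Z, ι := a, π := b, ι_π := w, shortExact := hS,
      d_eq := ChainComplex.of_d _ (fun i => b (i + 1) ≫ a i) }, rfl, hX⟩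

lemma exists_int_sequence {α : Type*} {p q : α → Prop} {r s : α → α → Prop}
    (hr : ∀ x, p x → ∃ y, p y ∧ r y x) (hs : ∀ x, q x → ∃ y, q y ∧ s x y)
    {x : α} (hp : p x) (hq : q x) :
    ∃ f : ℤ → α, f 0 = x ∧ (∀ i, 0 ≤ i → p (f i) ∧ r (f (i + 1)) (f i)) ∧
      ∀ i, i < 0 → q (f i) ∧ s (f (i + 1)) (f i) := by
  choose a ha ha' using fun y : Subtype p => hr y.1 y.2
  choose b hb hb' using fun y : Subtype q => hs y.1 y.2
  let F (n : ℕ) : Subtype p := (fun y => ⟨a y, ha y⟩)^[n] ⟨x, hp⟩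
  let G (n : ℕ) : Subtype q := (fun y => ⟨b y, hb y⟩)^[n] ⟨x, hq⟩
  have hF (n : ℕ) : r (F (n + 1)).1 (F n).1 := by
    simpa only [F, Function.iterate_succ_apply'] using ha' (F n)
  have hG (n : ℕ) : s (G n).1 (G (n + 1)).1 := by
    simpa only [G, Function.iterate_succ_apply'] using hb' (G n)
  let f : ℤ → α
    | .ofNat n => (F n).1
    | .negSucc n => (G (n + 1)).1
  refine ⟨f, rfl, ?_, ?_⟩
  · rintro (n | n) hn
    · exact ⟨(F n).2, hF n⟩
    · omega
  · rintro (n | n | n) hn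
    · exact absurd hn (Int.natCast_nonneg n).not_gt
    · exact ⟨(G 1).2, hG 0⟩
    · exact ⟨(G (n + 2)).2, hG (n + 1)⟩

/-- The class of images of `E₀ ⟶ E₋₁` in exact, `Hom(-, 𝓗)`-exact sequences `E` with `Eᵢ` in `𝓟`
for `i ≥ 0` and in `𝓠` for `i < 0`; the class `dcProjectiveComplexes` is an instance. -/
def completelyResolved (𝓟 𝓠 𝓗 : ObjectProperty A) : ObjectProperty A :=
  fun X => ∃ E : ChainComplex A ℤ, E.Acyclic ∧ IsHomExact 𝓗 E ∧ (∀ i : ℤ, 0 ≤ i → 𝓟 (E.X i)) ∧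
    (∀ i : ℤ, i < 0 → 𝓠 (E.X i)) ∧ Nonempty (X ≅ image (E.d 0 (-1)))

variable [HasExt.{u} A] {𝓟 𝓠 𝓗 : ObjectProperty A}

lemma completelyResolved_le_properlyCoresolved (h𝓟 : 𝓟 ≤ extOrthogonal 𝓗)
    (h𝓠 : 𝓠 ≤ extOrthogonal 𝓗) : completelyResolved 𝓟 𝓠 𝓗 ≤ properlyCoresolved 𝓠 𝓗 := by
  rintro X ⟨E, hE, hH, hEP, hEQ, ⟨e⟩⟩
  have hE' (i : ℤ) : extOrthogonal 𝓗 (E.X i) :=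
    (le_or_gt 0 i).elim (fun hi => h𝓟 _ (hEP i hi)) fun hi => h𝓠 _ (hEQ i hi)
  let σ := opcyclesSplicing hE
  obtain ⟨e'⟩ := σ.nonempty_iso_image (i := 0) (j := -1) rfl
  refine ObjectProperty.prop_of_iso _ (e' ≪≫ e.symm)
    ⟨fun W => ∃ i ≤ (0 : ℤ), σ.Z i = W, ?_, ?_, 0, le_rfl, rfl⟩
  · rintro _ ⟨i, -, rfl⟩
    exact σ.extOrthogonal_Z hH hE' i
  · rintro _ ⟨i, hi, rfl⟩
    obtain ⟨i, rfl⟩ : ∃ j, i = j + 1 := ⟨i - 1, by omega⟩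
    exact ⟨_, ⟨i, by omega, rfl⟩, _, _, _, _, σ.shortExact i, hEQ i (by omega)⟩

lemma properlyCoresolved_le_completelyResolved [EnoughProjectives A] (h𝓟 : isProjective A ≤ 𝓟) :
    properlyCoresolved 𝓠 𝓗 ≤ completelyResolved 𝓟 𝓠 𝓗 := by
  intro X hX
  obtain ⟨Z, rfl, hZP, hZQ⟩ := exists_int_sequence (p := extOrthogonal 𝓗)
    (q := properlyCoresolved 𝓠 𝓗) (r := IsSyzygy (isProjective A)) (s := IsSyzygy 𝓠)
    (fun Y hY =>
      have hZ := isSyzygy_kernel (𝓔 := isProjective A) (Projective.π Y)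
        (Projective.projective_over Y)
      ⟨_, extOrthogonal_of_isSyzygy isProjective_le_extOrthogonal hZ hY, hZ⟩)
    (fun Y hY => exists_isSyzygy_of_properlyCoresolved hY)
    (properlyCoresolved_le_extOrthogonal _ hX) hX
  obtain ⟨E, σ, rfl, hE⟩ := exists_splicing (Z := Z)
    (𝓔 := fun i Y => (0 ≤ i → 𝓟 Y) ∧ (i < 0 → 𝓠 Y)) fun i => by
      obtain hi | hi := le_or_gt 0 i
      · obtain ⟨E, a, b, w, hS, hE⟩ := (hZP i hi).2
        exact ⟨E, a, b, w, hS, fun _ => h𝓟 _ hE, fun hi' => absurd hi hi'.not_ge⟩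
      · obtain ⟨E, a, b, w, hS, hE⟩ := (hZQ i hi).2
        exact ⟨E, a, b, w, hS, fun hi' => absurd hi hi'.not_gt, fun _ => hE⟩
  have hZ (i : ℤ) : extOrthogonal 𝓗 (σ.Z i) :=
    (le_or_gt 0 i).elim (fun hi => (hZP i hi).1) fun hi =>
      properlyCoresolved_le_extOrthogonal _ (hZQ i hi).1
  exact ⟨E, σ.acyclic, σ.isHomExact_iff.2 fun i H hH =>
      comp_left_surjective_of_ext (σ.shortExact i) (hZ i H hH 0),
    fun i => (hE i).1, fun i => (hE i).2, σ.nonempty_iso_image rfl⟩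

theorem isProjectivelyResolving_completelyResolved [EnoughProjectives A]
    (h𝓟 : isProjective A ≤ 𝓟) (h𝓟' : 𝓟 ≤ properlyCoresolved 𝓠 𝓗) (h𝓠 : 𝓠 ≤ extOrthogonal 𝓗)
    (h𝓠' : 𝓠 ≤ 𝓗) (hQ : ∀ Q Q', 𝓠 Q → 𝓠 Q' → 𝓠 (Q ⊞ Q')) :
    IsProjectivelyResolving (completelyResolved 𝓟 𝓠 𝓗) := by
  have h := le_antisymm (completelyResolved_le_properlyCoresolved
    (h𝓟'.trans properlyCoresolved_le_extOrthogonal) h𝓠)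
    (properlyCoresolved_le_completelyResolved h𝓟)
  rw [h]
  exact ⟨h𝓟.trans h𝓟', fun S hS h₃ =>
    ⟨fun h₂ => properlyCoresolved_X₁ h𝓠' hQ hS h₂ h₃,
      fun h₁ => properlyCoresolved_X₂ h𝓠' hQ hS h₁ h₃⟩⟩

end CompleteResolutions

section DiskSums

open Limits Abelian

variable {A : Type w} [Category.{v} A] [Abelian A]

lemma shortExact_biprod_map {S T : ShortComplex A} (hS : S.ShortExact) (hT : T.ShortExact) :
    (ShortComplex.mk (biprod.map S.f T.f) (biprod.map S.g T.g) (by ext <;> simp)).ShortExact := by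
  have := hS.mono_f
  have := hS.epi_g
  have := hT.mono_f
  have := hT.epi_g
  have lift {W : A} (k : W ⟶ S.X₂ ⊞ T.X₂) (hk : k ≫ biprod.map S.g T.g = 0) :
      { l : W ⟶ S.X₁ ⊞ T.X₁ // l ≫ biprod.map S.f T.f = k } :=
    ⟨biprod.lift
      (hS.exact.lift (k ≫ biprod.fst) (by simpa using hk =≫ biprod.fst))
      (hT.exact.lift (k ≫ biprod.snd) (by simpa using hk =≫ biprod.snd)), by ext <;> simp⟩
  have h₁ : Mono (biprod.map S.f T.f) := inferInstance
  have h₂ : Epi (biprod.map S.g T.g) := inferInstance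
  exact { exact := ShortComplex.exact_of_f_is_kernel _ (KernelFork.IsLimit.ofι' _ _ lift) }

/-- The contractible complex with `M i ⊞ M (i + 1)` in degree `i`, that is, the direct sum of the
disk complexes `⋯ ⟶ 0 ⟶ M i = M i ⟶ 0 ⟶ ⋯` in degrees `i` and `i - 1`. It is left adjoint to
forgetting the differential. -/
noncomputable def diskSum (M : ℤ → A) : ChainComplex A ℤ :=
  .of (fun i => M i ⊞ M (i + 1)) (fun _ => biprod.fst ≫ biprod.inr) (by simp)

namespace diskSum

/-- The terms of `diskSum M`, as biproducts. -/
noncomputable def XIso (M : ℤ → A) (i : ℤ) : (diskSum M).X i ≅ M i ⊞ M (i + 1) := Iso.refl _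

lemma d_eq (M : ℤ → A) (i : ℤ) :
    (diskSum M).d (i + 1) i = (XIso M (i + 1)).hom ≫ biprod.fst ≫ biprod.inr ≫ (XIso M i).inv :=
  (ChainComplex.of_d (fun i => M i ⊞ M (i + 1)) (fun _ => biprod.fst ≫ biprod.inr) i).trans
    ((Category.id_comp _).trans (congrArg _ (Category.comp_id _))).symm

/-- The decomposition of `diskSum M` with `Z = M`. -/
noncomputable def splicing (M : ℤ → A) : Splicing (diskSum M) where
  Z := M
  ι i := biprod.inr ≫ (XIso M i).inv
  π i := (XIso M i).hom ≫ biprod.fst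
  ι_π i := by simp
  shortExact i :=
    ShortComplex.Splitting.shortExact
      { r := (XIso M i).hom ≫ biprod.snd
        s := biprod.inl ≫ (XIso M i).inv
        f_r := by simp
        s_g := by simp
        id := by
          rw [← cancel_epi (XIso M i).inv, ← cancel_mono (XIso M i).hom]
          ext <;> simp }
  d_eq i := by simp [d_eq]

/-- The unit `M ⟶ diskSum M` of the adjunction, in degree `i`. -/
noncomputable def unit (M : ℤ → A) (i : ℤ) : M i ⟶ (diskSum M).X i := biprod.inl ≫ (XIso M i).inv

variable {M N : ℤ → A} {X : ChainComplex A ℤ}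

lemma hom_ext {φ ψ : diskSum M ⟶ X} (h : ∀ i, unit M i ≫ φ.f i = unit M i ≫ ψ.f i) : φ = ψ := by
  have inr_eq (i : ℤ) : biprod.inr ≫ (XIso M i).inv = unit M (i + 1) ≫ (diskSum M).d (i + 1) i := by
    simp [unit, d_eq]
  ext i
  rw [← cancel_epi (XIso M i).inv]
  ext
  · simpa [unit] using h i
  · simpa [reassoc_of% inr_eq i] using h (i + 1) =≫ X.d (i + 1) i

/-- The morphism `diskSum M ⟶ X` adjoint to a family of morphisms `M i ⟶ X.X i`. -/
noncomputable def desc (g : ∀ i, M i ⟶ X.X i) : diskSum M ⟶ X where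
  f i := (XIso M i).hom ≫ biprod.desc (g i) (g (i + 1) ≫ X.d (i + 1) i)
  comm' i j hij := by
    obtain rfl : j + 1 = i := hij
    rw [← cancel_epi (XIso M (j + 1)).inv]
    ext <;> simp [d_eq]

@[simp]
lemma unit_desc (g : ∀ i, M i ⟶ X.X i) (i : ℤ) : unit M i ≫ (desc g).f i = g i := by
  simp [unit, desc]

/-- The functoriality of `diskSum`. -/
noncomputable def map (g : ∀ i, M i ⟶ N i) : diskSum M ⟶ diskSum N where
  f i := (XIso M i).hom ≫ biprod.map (g i) (g (i + 1)) ≫ (XIso N i).inv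
  comm' i j hij := by
    obtain rfl : j + 1 = i := hij
    simp [d_eq]

lemma shortExact_map {S : ℤ → ShortComplex A} (hS : ∀ i, (S i).ShortExact) :
    (ShortComplex.mk (map fun i => (S i).f) (map fun i => (S i).g)
      (hom_ext fun i => by simp [unit, map])).ShortExact :=
  HomologicalComplex.shortExact_of_degreewise_shortExact _ fun i =>
    ShortComplex.shortExact_of_iso
      (ShortComplex.isoMk (XIso (fun i => (S i).X₁) i).symm (XIso (fun i => (S i).X₂) i).symm
        (XIso (fun i => (S i).X₃) i).symm
        ((XIso (fun i => (S i).X₁) i).inv_hom_id_assoc _)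
        ((XIso (fun i => (S i).X₂) i).inv_hom_id_assoc _))
      (shortExact_biprod_map (hS i) (hS (i + 1)))

instance [∀ i, Projective (M i)] : Projective (diskSum M) where
  factors f e _ :=
    ⟨desc fun i => Projective.factorThru (unit M i ≫ f.f i) (e.f i), hom_ext fun i => by
      rw [HomologicalComplex.comp_f, reassoc_of% unit_desc, Projective.factorThru_comp]⟩

lemma epi_desc (g : ∀ i, M i ⟶ X.X i) [∀ i, Epi (g i)] : Epi (desc g) :=
  have (i : ℤ) : Epi ((desc g).f i) := epi_of_epi_fac (unit_desc g i)
  HomologicalComplex.epi_of_epi_f _ this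

end diskSum

instance [EnoughProjectives A] : EnoughProjectives (ChainComplex A ℤ) where
  presentation X := ⟨
    { p := diskSum fun i => Projective.over (X.X i)
      f := diskSum.desc fun i => Projective.π (X.X i)
      epi := diskSum.epi_desc _ }⟩

lemma Splicing.nonempty_iso_diskSum {X : ChainComplex A ℤ} (σ : Splicing X)
    (h : ∀ i, IsSplitEpi (σ.π i)) : Nonempty (X ≅ diskSum σ.Z) := by
  let φ : diskSum σ.Z ⟶ X := diskSum.desc fun i => section_ (σ.π i)
  let τ := diskSum.splicing σ.Z
  have hφ (i : ℤ) : IsIso (φ.f i) := by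
    let ψ : ShortComplex.mk (τ.ι i) (τ.π i) (τ.ι_π i) ⟶
        ShortComplex.mk (σ.ι i) (σ.π i) (σ.ι_π i) :=
      { τ₁ := 𝟙 (σ.Z (i + 1))
        τ₂ := φ.f i
        τ₃ := 𝟙 (σ.Z i)
        comm₁₂ := by simp [φ, τ, diskSum.splicing, diskSum.desc, σ.d_eq]
        comm₂₃ := by
          rw [← cancel_epi (diskSum.XIso σ.Z i).inv]
          ext <;> simp [φ, τ, diskSum.splicing, diskSum.desc, σ.d_eq, σ.ι_π] }
    exact ShortComplex.isIso₂_of_shortExact_of_isIso₁₃' ψ (τ.shortExact i) (σ.shortExact i)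
      (inferInstanceAs (IsIso (𝟙 _))) (inferInstanceAs (IsIso (𝟙 _)))
  have := HomologicalComplex.Hom.isIso_of_components φ
  exact ⟨(asIso φ).symm⟩

end DiskSums

section SplicedComplexes

universe u'

open Limits Abelian

variable {A : Type w} [Category.{v} A] [Abelian A]

/-- The class of exact complexes all of whose cycle objects lie in `𝓧`, described by their
decompositions into short exact sequences; for modules this is `complexesOf 𝓧`. -/
def splicedComplexes (𝓧 : ObjectProperty A) : ObjectProperty (ChainComplex A ℤ) :=
  fun X => ∃ σ : Splicing X, ∀ i, 𝓧 (σ.Z i)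

variable {𝓧 𝓠 𝓗 : ObjectProperty A}

lemma splicedComplexes_mono (h : 𝓠 ≤ 𝓗) : splicedComplexes 𝓠 ≤ splicedComplexes 𝓗 :=
  fun _ ⟨σ, hσ⟩ => ⟨σ, fun i => h _ (hσ i)⟩

lemma splicedComplexes_iff [𝓧.IsClosedUnderIsomorphisms] {X : ChainComplex A ℤ} :
    splicedComplexes 𝓧 X ↔ X.Acyclic ∧ ∀ i, 𝓧 (X.cycles i) := by
  refine ⟨fun ⟨σ, hσ⟩ => ⟨σ.acyclic, fun i => ?_⟩,
    fun ⟨hX, h⟩ => ⟨opcyclesSplicing hX, fun i => ?_⟩⟩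
  · obtain ⟨e⟩ := σ.nonempty_iso_cycles i
    exact 𝓧.prop_of_iso e (hσ (i + 1))
  · obtain ⟨i, rfl⟩ : ∃ j, i = j + 1 := ⟨i - 1, by omega⟩
    obtain ⟨e⟩ := (opcyclesSplicing hX).nonempty_iso_cycles i
    exact 𝓧.prop_of_iso e.symm (h i)

lemma splicedComplexes_diskSum {M : ℤ → A} (hM : ∀ i, 𝓧 (M i)) : splicedComplexes 𝓧 (diskSum M) :=
  ⟨diskSum.splicing M, hM⟩

instance [𝓧.IsStableUnderRetracts] : (splicedComplexes 𝓧).IsStableUnderRetracts where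
  of_retract {X Y} h := by
    rw [splicedComplexes_iff, splicedComplexes_iff]
    rintro ⟨hY, hY'⟩
    refine ⟨fun i => ?_, fun i => 𝓧.prop_of_retract
      (h.map (HomologicalComplex.cyclesFunctor A _ i)) (hY' i)⟩
    rw [HomologicalComplex.exactAt_iff_isZero_homology, IsZero.iff_id_eq_zero]
    have r : Retract (X.homology i) (Y.homology i) :=
      h.map (HomologicalComplex.homologyFunctor A _ i)
    rw [← r.retract, (hY i).isZero_homology.eq_zero_of_tgt r.i, zero_comp]

/-- The biproduct of two decompositions into short exact sequences. -/
noncomputable def Splicing.biprod {X Y : ChainComplex A ℤ} (σ : Splicing X) (τ : Splicing Y) :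
    Splicing (X ⊞ Y) where
  Z i := σ.Z i ⊞ τ.Z i
  ι i := Limits.biprod.map (σ.ι i) (τ.ι i) ≫ (HomologicalComplex.biprodXIso X Y i).inv
  π i := (HomologicalComplex.biprodXIso X Y i).hom ≫ Limits.biprod.map (σ.π i) (τ.π i)
  ι_π i := by ext <;> simp [σ.ι_π, τ.ι_π]
  shortExact i :=
    ShortComplex.shortExact_of_iso
      (S₁ := .mk (Limits.biprod.map (σ.ι i) (τ.ι i)) (Limits.biprod.map (σ.π i) (τ.π i)) (by
        ext <;> simp [σ.ι_π, τ.ι_π]))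
      (ShortComplex.isoMk (Iso.refl _) (HomologicalComplex.biprodXIso X Y i).symm (Iso.refl _)
        (by simp) (by simp))
      (shortExact_biprod_map (σ.shortExact i) (τ.shortExact i))
  d_eq i := by
    rw [← cancel_mono (HomologicalComplex.biprodXIso X Y i).hom]
    ext <;> simp [σ.d_eq, τ.d_eq]

lemma splicedComplexes_biprod (h : ∀ M N, 𝓧 M → 𝓧 N → 𝓧 (M ⊞ N)) {X Y : ChainComplex A ℤ}
    (hX : splicedComplexes 𝓧 X) (hY : splicedComplexes 𝓧 Y) : splicedComplexes 𝓧 (X ⊞ Y) := by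
  obtain ⟨σ, hσ⟩ := hX
  obtain ⟨τ, hτ⟩ := hY
  exact ⟨σ.biprod τ, fun i => h _ _ (hσ i) (hτ i)⟩

variable [HasExt.{u} A]

lemma exists_iso_diskSum (h𝓧 : ∀ M N, 𝓧 M → 𝓧 N → Subsingleton (Ext M N 1))
    {X : ChainComplex A ℤ} (hX : splicedComplexes 𝓧 X) :
    ∃ M : ℤ → A, (∀ i, 𝓧 (M i)) ∧ Nonempty (X ≅ diskSum M) := by
  obtain ⟨σ, hσ⟩ := hX
  refine ⟨σ.Z, hσ, σ.nonempty_iso_diskSum fun i => ?_⟩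
  obtain ⟨r, hr⟩ := comp_left_surjective_of_ext (σ.shortExact i) (h𝓧 _ _ (hσ i) (hσ (i + 1)))
    (𝟙 (σ.Z (i + 1)))
  exact IsSplitEpi.mk' (ShortComplex.Splitting.ofExactOfRetraction _ (σ.shortExact i).exact r hr
    inferInstance).splitEpi_g

instance : (isProjective A).IsStableUnderRetracts where
  of_retract h hY := h.projective (p := hY)

variable [EnoughProjectives A]

lemma splicedComplexes_isProjective :
    splicedComplexes (isProjective A) = isProjective (ChainComplex A ℤ) := by
  ext X
  refine ⟨fun hX => ?_, fun (hX : Projective X) => ?_⟩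
  · obtain ⟨M, hM, ⟨e⟩⟩ := exists_iso_diskSum
      (fun P N (_ : Projective P) _ => Ext.subsingleton_of_projective P N 0) hX
    have (i : ℤ) : Projective (M i) := hM i
    exact Projective.of_iso e.symm inferInstance
  · let p := diskSum.desc fun i => Projective.π (X.X i)
    have : Epi p := diskSum.epi_desc _
    exact ObjectProperty.prop_of_retract _
      { i := Projective.factorThru (𝟙 X) p, r := p }
      (splicedComplexes_diskSum fun i => Projective.projective_over (X.X i))

variable [HasExt.{u'} (ChainComplex A ℤ)]

lemma extOrthogonal_diskSum {M : ℤ → A} (hM : ∀ i, extOrthogonal 𝓗 (M i)) :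
    extOrthogonal (splicedComplexes 𝓗) (diskSum M) := by
  let S (N : A) : ShortComplex A := .mk _ _ (kernel.condition (Projective.π N))
  have hS (N : A) : (S N).ShortExact := { exact := ShortComplex.exact_kernel _ }
  let next (N : ℤ → Subtype (extOrthogonal 𝓗)) (i : ℤ) : Subtype (extOrthogonal 𝓗) :=
    ⟨(S (N i).1).X₁, extOrthogonal_X₁ (hS (N i).1)
      (isProjective_le_extOrthogonal _ (Projective.projective_over _)) (N i).2⟩
  refine extOrthogonal_of_syzygies next _ (fun N => diskSum.shortExact_map fun i => hS (N i).1)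
    (fun N => Iso.refl _) (fun N => isProjective_le_extOrthogonal _ ?_) ?_ fun i => ⟨M i, hM i⟩
  · exact inferInstanceAs (Projective (diskSum fun i => Projective.over (N i).1))
  · rintro N X ⟨σ, hσ⟩ f
    choose g hg using fun i => comp_left_surjective_of_ext (hS (N i).1)
      (subsingleton_ext_to_X₂ (σ.shortExact i) ((N i).2 _ (hσ (i + 1)) 0) ((N i).2 _ (hσ i) 0))
      (diskSum.unit (fun i => (S (N i).1).X₁) i ≫ f.f i)
    refine ⟨diskSum.desc g, diskSum.hom_ext fun i => ?_⟩
    simpa [diskSum.map, diskSum.unit, diskSum.desc] using hg i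

lemma splicedComplexes_le_extOrthogonal (h𝓠 : 𝓠 ≤ extOrthogonal 𝓗) (h𝓠' : 𝓠 ≤ 𝓗) :
    splicedComplexes 𝓠 ≤ extOrthogonal (splicedComplexes 𝓗) := by
  intro X hX
  obtain ⟨M, hM, ⟨e⟩⟩ := exists_iso_diskSum (fun M N hM hN => h𝓠 M hM N (h𝓠' N hN) 0) hX
  exact ObjectProperty.prop_of_iso _ e.symm (extOrthogonal_diskSum fun i => h𝓠 _ (hM i))

lemma properlyCoresolved_diskSum {M : ℤ → A} (hM : ∀ i, properlyCoresolved 𝓠 𝓗 (M i)) :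
    properlyCoresolved (splicedComplexes 𝓠) (splicedComplexes 𝓗) (diskSum M) := by
  refine ⟨fun W => ∃ N, (∀ i, properlyCoresolved 𝓠 𝓗 (N i)) ∧ diskSum N = W, ?_, ?_, M, hM, rfl⟩
  · rintro _ ⟨N, hN, rfl⟩
    exact extOrthogonal_diskSum fun i => properlyCoresolved_le_extOrthogonal _ (hN i)
  · rintro _ ⟨N, hN, rfl⟩
    choose N' hN' Q a b w hS hQ using fun i => exists_isSyzygy_of_properlyCoresolved (hN i)
    exact ⟨_, ⟨N', hN', rfl⟩, _, _, _, _, diskSum.shortExact_map hS, splicedComplexes_diskSum hQ⟩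

end SplicedComplexes

section ResolvingComplexes

open Limits Abelian

variable {A : Type w} [Category.{v} A] [Abelian A] [EnoughProjectives A] [HasExt.{u} A]
  {𝓠 𝓗 : ObjectProperty A}

theorem isProjectivelyResolving_spliced (h𝓠 : 𝓠 ≤ extOrthogonal 𝓗)
    (h𝓠' : 𝓠 ≤ 𝓗) (hQ : ∀ Q Q', 𝓠 Q → 𝓠 Q' → 𝓠 (Q ⊞ Q'))
    (hP : isProjective A ≤ properlyCoresolved 𝓠 𝓗) :
    IsProjectivelyResolving (completelyResolved (splicedComplexes (isProjective A))
      (splicedComplexes 𝓠) (splicedComplexes 𝓗)) := by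
  have := HasExt.standard (ChainComplex A ℤ)
  have hP' : splicedComplexes (isProjective A) ≤
      properlyCoresolved (splicedComplexes 𝓠) (splicedComplexes 𝓗) := by
    intro X hX
    obtain ⟨M, hM, ⟨e⟩⟩ := exists_iso_diskSum
      (fun P N (_ : Projective P) _ => Ext.subsingleton_of_projective P N 0) hX
    exact ObjectProperty.prop_of_iso _ e.symm (properlyCoresolved_diskSum fun i => hP _ (hM i))
  exact isProjectivelyResolving_completelyResolved splicedComplexes_isProjective.ge hP'
    (splicedComplexes_le_extOrthogonal h𝓠 h𝓠') (splicedComplexes_mono h𝓠')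
    fun _ _ hQ₁ hQ₂ => splicedComplexes_biprod hQ hQ₁ hQ₂

end ResolvingComplexes

section Resolutions

open Limits Abelian

variable {A : Type w} [Category.{v} A] [Abelian A] {X : A}

/-- The short exact sequence `0 ⟶ K (n + 1) ⟶ P n ⟶ K n ⟶ 0` of a projective resolution `P`, where
the `n`-th syzygy `K n` is the cokernel of `P (n + 1) ⟶ P n`. -/
noncomputable abbrev syzygySequence (P : ProjectiveResolution X) (n : ℕ) : ShortComplex A :=
  .mk (P.complex.fromOpcycles (n + 1) n) (P.complex.pOpcycles n)
    (by simp [← cancel_epi (P.complex.pOpcycles (n + 1))])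

variable (P : ProjectiveResolution X)

lemma shortExact_syzygySequence (n : ℕ) : (syzygySequence P n).ShortExact :=
  shortExact_opcycles P.complex (by simp) (P.complex_exactAt_succ n)

/-- The zeroth syzygy of a projective resolution of `X` is `X`. -/
noncomputable def opcyclesZeroIso : P.complex.opcycles 0 ≅ X :=
  (P.complex.opcyclesIsCokernel 1 0 (by simp)).coconePointUniqueUpToIso P.isColimitCokernelCofork

lemma extOrthogonal_syzygy [HasExt.{u} A] {𝓗 : ObjectProperty A} (hX : extOrthogonal 𝓗 X) (n : ℕ) :
    extOrthogonal 𝓗 (P.complex.opcycles n) := by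
  induction n with
  | zero => exact ObjectProperty.prop_of_iso _ (opcyclesZeroIso P).symm hX
  | succ n ih =>
    exact extOrthogonal_X₁ (shortExact_syzygySequence P n)
      (isProjective_le_extOrthogonal _ (P.projective n)) ih

end Resolutions

section TensorHom

open LinearMap TensorProduct

variable {R : Type u} [CommRing R] {K K' Q N F P X Y H C : Type*}
  [AddCommGroup K] [Module R K] [AddCommGroup K'] [Module R K'] [AddCommGroup Q] [Module R Q]
  [AddCommGroup N] [Module R N] [AddCommGroup F] [Module R F] [AddCommGroup P] [Module R P]
  [AddCommGroup X] [Module R X] [AddCommGroup Y] [Module R Y] [AddCommGroup H] [Module R H]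
  [AddCommGroup C] [Module R C]

lemma rTensorHomToHomRTensor_rTensor_lcomp (p : Q →ₗ[R] K) (x : (K →ₗ[R] N) ⊗[R] F) :
    rTensorHomToHomRTensor (.id R) Q N F ((lcomp R N p).rTensor F x) =
      rTensorHomToHomRTensor (.id R) K N F x ∘ₗ p := by
  induction x with
  | zero => simp
  | tmul f y => ext q; simp
  | add x y hx hy => simp only [map_add, hx, hy, add_comp]

lemma rTensorHomToHomRTensor_injective [Module.Finite R K] [Module.Flat R F] :
    Function.Injective (rTensorHomToHomRTensor (.id R) K N F) := by
  obtain ⟨n, p, hp⟩ := Module.Finite.exists_fin' R K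
  have hfree : Function.Injective (rTensorHomToHomRTensor (.id R) (Fin n → R) N F) := by
    rw [← rTensorHomEquivHomRTensor_toLinearMap]
    exact (rTensorHomEquivHomRTensor R (Fin n → R) N F).injective
  refine Function.Injective.of_comp (f := lcomp R (N ⊗[R] F) p) ?_
  convert hfree.comp (Module.Flat.rTensor_preserves_injective_linearMap (M := F) _
    (lcomp_injective_of_surjective (N := N) (S := R) p hp)) using 1
  exact funext fun x => (rTensorHomToHomRTensor_rTensor_lcomp p x).symm

lemma rTensorHomToHomRTensor_surjective [Module.FinitePresentation R K] [Module.Flat R F] :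
    Function.Surjective (rTensorHomToHomRTensor (.id R) K N F) := by
  obtain ⟨n, p, hp⟩ := Module.Finite.exists_fin' R K
  have hker : Module.Finite R (ker p) :=
    Module.Finite.iff_fg.2 (Module.FinitePresentation.fg_ker p hp)
  have exact_p : Function.Exact (ker p).subtype p := p.exact_subtype_ker_map
  intro g
  obtain ⟨x, hx⟩ := (rTensorHomEquivHomRTensor R (Fin n → R) N F).surjective (g ∘ₗ p)
  rw [rTensorHomEquivHomRTensor_apply] at hx
  have x_mem_ker : (lcomp R N (ker p).subtype).rTensor F x = 0 := by
    refine (injective_iff_map_eq_zero _).1 rTensorHomToHomRTensor_injective _ ?_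
    rw [rTensorHomToHomRTensor_rTensor_lcomp, hx, comp_assoc, exact_p.linearMap_comp_eq_zero,
      comp_zero]
  obtain ⟨y, rfl⟩ := (Module.Flat.rTensor_exact F
    (exact_lcomp_of_exact_of_surjective N exact_p hp) x).1 x_mem_ker
  refine ⟨y, lcomp_injective_of_surjective (S := R) p hp ?_⟩
  rwa [rTensorHomToHomRTensor_rTensor_lcomp] at hx

lemma lcomp_surjective_congr (e : N ≃ₗ[R] H) {j : X →ₗ[R] Y}
    (hj : Function.Surjective (lcomp R N j)) : Function.Surjective (lcomp R H j) := by
  intro g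
  obtain ⟨g', hg'⟩ := hj (e.symm ∘ₗ g)
  exact ⟨e.toLinearMap ∘ₗ g', LinearMap.ext fun x =>
    (congrArg e (LinearMap.congr_fun hg' x)).trans (e.apply_symm_apply _)⟩

lemma lcomp_surjective_tensor [Module.FinitePresentation R X] [Module.Flat R F]
    {j : X →ₗ[R] Y} (hj : Function.Surjective (lcomp R N j)) :
    Function.Surjective (lcomp R (N ⊗[R] F) j) := by
  intro g
  obtain ⟨x, rfl⟩ := rTensorHomToHomRTensor_surjective g
  obtain ⟨y, rfl⟩ := rTensor_surjective F hj x
  exact ⟨_, (rTensorHomToHomRTensor_rTensor_lcomp j y).symm⟩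

lemma lcomp_rTensor_surjective [Module.Projective R P] {j : X →ₗ[R] Y}
    (hj : Function.Surjective (lcomp R H j)) :
    Function.Surjective (lcomp R H (j.rTensor P)) := by
  intro g
  obtain ⟨h, hh⟩ := Module.projective_lifting_property (lcomp R H j) (curry g).flip hj
  exact ⟨lift h.flip, TensorProduct.ext' fun x p =>
    LinearMap.congr_fun (LinearMap.congr_fun hh p) x⟩

lemma mk_flip_bijective [Module.FinitePresentation R C] [Module.Flat R F]
    (hC : Function.Bijective (lsmul R C)) : Function.Bijective (TensorProduct.mk R C F).flip := by
  let e : F ≃ₗ[R] (C →ₗ[R] C) ⊗[R] F := (TensorProduct.lid R F).symm ≪≫ₗ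
    (LinearEquiv.ofBijective (lsmul R C : R →ₗ[R] C →ₗ[R] C) hC).rTensor F
  have h : (TensorProduct.mk R C F).flip =
      rTensorHomToHomRTensor (.id R) C C F ∘ₗ e.toLinearMap := by
    ext f c
    simp [e]
  have bijective : Function.Bijective (rTensorHomToHomRTensor (.id R) C C F) :=
    ⟨rTensorHomToHomRTensor_injective, rTensorHomToHomRTensor_surjective⟩
  rw [h]
  exact bijective.comp e.bijective

variable (R K F C) in
/-- The evaluation map `K ⊗ F ⟶ Hom(Hom(K, C), C ⊗ F)`; for `F = R` it is the biduality map of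
`K` with respect to `C`. -/
noncomputable def tensorBidual : K ⊗[R] F →ₗ[R] (K →ₗ[R] C) →ₗ[R] C ⊗[R] F :=
  (rTensorHom F).flip

@[simp]
lemma tensorBidual_apply (x : K ⊗[R] F) (φ : K →ₗ[R] C) :
    tensorBidual R K F C x φ = φ.rTensor F x := rfl

lemma tensorBidual_rTensor (f : Q →ₗ[R] K) (x : Q ⊗[R] F) :
    tensorBidual R K F C (f.rTensor F x) = tensorBidual R Q F C x ∘ₗ lcomp R C f :=
  LinearMap.ext fun φ => (rTensor_comp_apply F φ f x).symm

lemma tensorBidual_self_bijective (hC : Function.Bijective (lsmul R C)) :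
    Function.Bijective (tensorBidual R C F C) := by
  constructor
  · refine (injective_iff_map_eq_zero _).2 fun x hx => ?_
    simpa using LinearMap.congr_fun hx LinearMap.id
  · intro ψ
    refine ⟨ψ LinearMap.id, LinearMap.ext fun φ => ?_⟩
    obtain ⟨r, rfl⟩ := hC.2 φ
    have lsmul_eq : lsmul R C r = r • LinearMap.id := by ext; simp
    simp [lsmul_eq]

lemma tensorBidual_ring_bijective [Module.FinitePresentation R C] [Module.Flat R F]
    (hC : Function.Bijective (lsmul R C)) : Function.Bijective (tensorBidual R R F C) := by
  let e : (C →ₗ[R] C ⊗[R] F) ≃ₗ[R] ((R →ₗ[R] C) →ₗ[R] C ⊗[R] F) :=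
    LinearEquiv.arrowCongr (ringLmapEquivSelf R R C).symm (.refl R _)
  have h : tensorBidual R R F C =
      e.toLinearMap ∘ₗ (TensorProduct.mk R C F).flip ∘ₗ (TensorProduct.lid R F).toLinearMap := by
    ext f φ
    simp [e]
  rw [h]
  exact e.bijective.comp ((mk_flip_bijective hC).comp (TensorProduct.lid R F).bijective)

lemma tensorBidual_bijective_of_sum_comp_eq_id {κ : Type*} (t : Finset κ) (s : κ → Q →ₗ[R] K)
    (e : κ → K →ₗ[R] Q) (hes : ∑ k ∈ t, e k ∘ₗ s k = LinearMap.id)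
    (hK : Function.Bijective (tensorBidual R K F C)) :
    Function.Bijective (tensorBidual R Q F C) := by
  constructor
  · refine (injective_iff_map_eq_zero _).2 fun x hx => ?_
    have hs (k : κ) : (s k).rTensor F x = 0 :=
      (injective_iff_map_eq_zero _).1 hK.1 _ (by rw [tensorBidual_rTensor, hx, zero_comp])
    calc x = (∑ k ∈ t, e k ∘ₗ s k).rTensor F x := by simp [hes]
      _ = ∑ k ∈ t, (e k).rTensor F ((s k).rTensor F x) := by
        rw [← coe_rTensorHom, map_sum, LinearMap.sum_apply]
        exact Finset.sum_congr rfl fun k _ => rTensor_comp_apply F (e k) (s k) x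
      _ = 0 := by simp [hs]
  · intro ψ
    choose y hy using fun k => hK.2 (ψ ∘ₗ lcomp R C (s k))
    refine ⟨∑ k ∈ t, (e k).rTensor F (y k), LinearMap.ext fun φ => ?_⟩
    calc tensorBidual R Q F C (∑ k ∈ t, (e k).rTensor F (y k)) φ
        = ∑ k ∈ t, ψ ((φ ∘ₗ e k) ∘ₗ s k) := by
          simp [tensorBidual_rTensor, hy, lcomp_apply', -tensorBidual_apply]
      _ = ψ (φ ∘ₗ ∑ k ∈ t, e k ∘ₗ s k) := by
          rw [← map_sum]
          congr 1
          ext q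
          simp
      _ = ψ φ := by rw [hes, comp_id]

lemma tensorBidual_bijective_of_projective [Module.Finite R Q] [Module.Projective R Q]
    [Module.FinitePresentation R C] [Module.Flat R F] (hC : Function.Bijective (lsmul R C)) :
    Function.Bijective (tensorBidual R Q F C) := by
  obtain ⟨x, hx⟩ := (dualTensorHom_bijective (R := R) (M := Q) (N := Q)).2 LinearMap.id
  obtain ⟨t, rfl⟩ := TensorProduct.exists_finset x
  refine tensorBidual_bijective_of_sum_comp_eq_id t (fun k => k.1)
    (fun k => toSpanSingleton R Q k.2) ?_ (tensorBidual_ring_bijective hC)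
  rw [← hx]
  ext q
  simp

variable {i : K' →ₗ[R] Q} {p : Q →ₗ[R] K}

lemma tensorBidual_bijective_of_exact [Module.Flat R F] (hi : Function.Injective i)
    (hip : Function.Exact i p) (hp : Function.Surjective p)
    (hC : Function.Surjective (lcomp R C i)) (hK : Function.Injective (tensorBidual R K F C))
    (hQ : Function.Bijective (tensorBidual R Q F C)) :
    Function.Bijective (tensorBidual R K' F C) := by
  constructor
  · refine (injective_iff_map_eq_zero _).2 fun x hx => ?_
    have hix : i.rTensor F x = 0 := (injective_iff_map_eq_zero _).1 hQ.1 _ (by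
      rw [tensorBidual_rTensor, hx, zero_comp])
    exact (injective_iff_map_eq_zero _).1
      (Module.Flat.rTensor_preserves_injective_linearMap i hi) _ hix
  · intro ψ
    obtain ⟨y, hy⟩ := hQ.2 (ψ ∘ₗ lcomp R C i)
    have hpy : p.rTensor F y = 0 := by
      refine (injective_iff_map_eq_zero _).1 hK _ ?_
      rw [tensorBidual_rTensor, hy, comp_assoc,
        (exact_lcomp_of_exact_of_surjective C hip hp).linearMap_comp_eq_zero, comp_zero]
    obtain ⟨x, rfl⟩ := (rTensor_exact F hip hp y).1 hpy
    exact ⟨x, (cancel_right hC).1 (by rw [← tensorBidual_rTensor, hy])⟩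

lemma lcomp_lcomp_surjective (hp : Function.Surjective p)
    (hK : Function.Surjective (tensorBidual R K F C)) :
    Function.Surjective (lcomp R (C ⊗[R] F) (lcomp R C p)) := by
  intro g
  obtain ⟨z, rfl⟩ := hK g
  obtain ⟨y, rfl⟩ := rTensor_surjective F hp z
  exact ⟨tensorBidual R Q F C y, (tensorBidual_rTensor p y).symm⟩

end TensorHom

section ModuleClasses

variable {R : Type u} [CommRing R] {C : Type u} [AddCommGroup C] [Module R C]

instance : (projectiveModules R).IsClosedUnderIsomorphisms where
  of_iso e (_ : Module.Projective R _) := Module.Projective.of_equiv e.toLinearEquiv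

instance : (cProjectiveModules R C).IsClosedUnderIsomorphisms where
  of_iso e := fun ⟨P, hP, ⟨e'⟩⟩ => ⟨P, hP, ⟨e.symm.toLinearEquiv.trans e'⟩⟩

instance : (cFlatModules R C).IsClosedUnderIsomorphisms where
  of_iso e := fun ⟨F, hF, ⟨e'⟩⟩ => ⟨F, hF, ⟨e.symm.toLinearEquiv.trans e'⟩⟩

lemma complexesOf_eq_splicedComplexes (𝓧 : ObjectProperty (ModuleCat.{u} R))
    [𝓧.IsClosedUnderIsomorphisms] : complexesOf 𝓧 = splicedComplexes 𝓧 :=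
  funext fun _ => propext splicedComplexes_iff.symm

lemma projectiveModules_eq_isProjective :
    projectiveModules R = isProjective (ModuleCat.{u} R) :=
  funext fun M => propext (IsProjective.iff_projective M)

lemma cProjectiveModules_le_cFlatModules : cProjectiveModules R C ≤ cFlatModules R C := by
  rintro M ⟨P, hP, e⟩
  exact ⟨P, inferInstance, e⟩

lemma cProjectiveModules_biprod {M N : ModuleCat.{u} R} (hM : cProjectiveModules R C M)
    (hN : cProjectiveModules R C N) : cProjectiveModules R C (M ⊞ N) := by
  obtain ⟨P, hP, ⟨e⟩⟩ := hM
  obtain ⟨P', hP', ⟨e'⟩⟩ := hN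
  exact ⟨ModuleCat.of R (P × P'), inferInstanceAs (Module.Projective R (P × P')),
    ⟨(ModuleCat.biprodIsoProd M N).toLinearEquiv ≪≫ₗ e.prodCongr e' ≪≫ₗ
      (TensorProduct.prodRight R R C P P').symm⟩⟩

lemma cProjectiveModules_hom_tensor (Q P : Type u) [AddCommGroup Q] [Module R Q]
    [Module.Finite R Q] [Module.Projective R Q] [AddCommGroup P] [Module R P]
    [Module.Projective R P] :
    cProjectiveModules R C (ModuleCat.of R ((Q →ₗ[R] C) ⊗[R] P)) :=
  ⟨ModuleCat.of R (Module.Dual R Q ⊗[R] P),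
    inferInstanceAs (Module.Projective R (Module.Dual R Q ⊗[R] P)),
    ⟨((LinearEquiv.ofBijective _ dualTensorHom_bijective).symm ≪≫ₗ
      TensorProduct.comm R _ _).rTensor P ≪≫ₗ TensorProduct.assoc R _ _ _⟩⟩

end ModuleClasses

section ModuleSequences

variable {R : Type u} [CommRing R] {S : ShortComplex (ModuleCat.{u} R)}

lemma comp_left_surjective_iff_lcomp {X Y H : ModuleCat.{u} R} {f : X ⟶ Y} :
    (Function.Surjective fun g : Y ⟶ H => f ≫ g) ↔
      Function.Surjective (LinearMap.lcomp R H f.hom) :=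
  ⟨fun h g => (h (ModuleCat.ofHom g)).imp' ModuleCat.Hom.hom fun _ hk =>
      congrArg ModuleCat.Hom.hom hk,
    fun h g => (h g.hom).imp' ModuleCat.ofHom fun _ hk => ModuleCat.hom_ext hk⟩

lemma function_exact_of_shortExact (hS : S.ShortExact) : Function.Exact S.f.hom S.g.hom :=
  (ShortComplex.ShortExact.moduleCat_exact_iff_function_exact S).1 hS.exact

lemma finitePresentation_X₃ (hS : S.ShortExact) [Module.Finite R S.X₁] [Module.Finite R S.X₂]
    [Module.Projective R S.X₂] : Module.FinitePresentation R S.X₃ := by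
  have := Module.finitePresentation_of_projective R S.X₂
  refine Module.finitePresentation_of_surjective S.g.hom hS.moduleCat_surjective_g ?_
  rw [← hS.exact.moduleCat_range_eq_ker, LinearMap.range_eq_map]
  exact Module.Finite.fg_top.map _

lemma shortExact_rTensor (hS : S.ShortExact) (P : Type u) [AddCommGroup P] [Module R P]
    [Module.Flat R P] :
    (ModuleCat.shortComplexOfCompEqZero (S.f.hom.rTensor P) (S.g.hom.rTensor P)
      (by rw [← LinearMap.rTensor_comp, ← ModuleCat.hom_comp, S.zero]; simp)).ShortExact :=
  ModuleCat.shortComplex_shortExact _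
    (rTensor_exact P (function_exact_of_shortExact hS) hS.moduleCat_surjective_g)
    (Module.Flat.rTensor_preserves_injective_linearMap _ hS.moduleCat_injective_f)
    (LinearMap.rTensor_surjective P hS.moduleCat_surjective_g)

variable {C : Type u} [AddCommGroup C] [Module R C]

lemma function_exact_lcomp (hS : S.ShortExact) :
    Function.Exact (LinearMap.lcomp R C S.g.hom) (LinearMap.lcomp R C S.f.hom) :=
  LinearMap.exact_lcomp_of_exact_of_surjective C (function_exact_of_shortExact hS)
    hS.moduleCat_surjective_g

lemma shortExact_lcomp (hS : S.ShortExact)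
    (h : Function.Surjective (LinearMap.lcomp R C S.f.hom)) :
    (ModuleCat.shortComplexOfCompEqZero (LinearMap.lcomp R C S.g.hom)
      (LinearMap.lcomp R C S.f.hom) (function_exact_lcomp hS).linearMap_comp_eq_zero).ShortExact :=
  ModuleCat.shortComplex_shortExact _ (function_exact_lcomp hS)
    (LinearMap.lcomp_injective_of_surjective (S := R) _ hS.moduleCat_surjective_g) h

end ModuleSequences

section Semidualizing

variable {R : Type u} [CommRing R] {C : Type u} [AddCommGroup C] [Module R C]

lemma extOrthogonal_of_isSemidualizing (hC : IsSemidualizing R C) :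
    extOrthogonal (.singleton (ModuleCat.of R C)) (ModuleCat.of R C) := by
  rintro _ ⟨⟩ n
  exact hC.ext_subsingleton (n + 1) (by omega)

variable (P : ProjectiveResolution (ModuleCat.of R C))

lemma lcomp_fromOpcycles_surjective (hC : IsSemidualizing R C) (n : ℕ) :
    Function.Surjective (LinearMap.lcomp R C (syzygySequence P n).f.hom) :=
  comp_left_surjective_iff_lcomp.1 (comp_left_surjective_of_ext (Y := ModuleCat.of R C)
    (shortExact_syzygySequence P n)
    (extOrthogonal_syzygy P (extOrthogonal_of_isSemidualizing hC) n _ ⟨⟨⟩⟩ 0))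

lemma shortExact_dual_syzygy_tensor (hC : IsSemidualizing R C) (n : ℕ) (Q : Type u)
    [AddCommGroup Q] [Module R Q] [Module.Flat R Q] :
    (ModuleCat.shortComplexOfCompEqZero
      ((LinearMap.lcomp R C (syzygySequence P n).g.hom).rTensor Q)
      ((LinearMap.lcomp R C (syzygySequence P n).f.hom).rTensor Q) (by
        rw [← LinearMap.rTensor_comp,
          (function_exact_lcomp (shortExact_syzygySequence P n)).linearMap_comp_eq_zero,
          LinearMap.rTensor_zero])).ShortExact :=
  shortExact_rTensor (shortExact_lcomp (shortExact_syzygySequence P n)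
    (lcomp_fromOpcycles_surjective P hC n)) Q

/-- Since `C` is semidualizing, `Hom(C, C) ⊗ Q` is `Q`; here `C` is replaced by the zeroth syzygy
of a resolution. -/
noncomputable def homTensorIso (hC : IsSemidualizing R C) (Q : ModuleCat.{u} R) :
    ModuleCat.of R ((P.complex.opcycles 0 →ₗ[R] C) ⊗[R] Q) ≅ Q :=
  ((LinearEquiv.congrLeft C R (opcyclesZeroIso P).toLinearEquiv ≪≫ₗ
    (LinearEquiv.ofBijective (LinearMap.lsmul R C : R →ₗ[R] C →ₗ[R] C)
      hC.homothety_bijective).symm).rTensor Q ≪≫ₗ TensorProduct.lid R Q).toModuleIso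

instance (n : ℕ) : Module.Projective R (P.complex.X n) :=
  (IsProjective.iff_projective _).2 (P.projective n)

variable [∀ n, Module.Finite R (P.complex.X n)]

instance (n : ℕ) : Module.Finite R ↑(P.complex.opcycles n) :=
  .of_surjective _ (shortExact_syzygySequence P n).moduleCat_surjective_g

instance (n : ℕ) : Module.FinitePresentation R ↑(P.complex.opcycles n) :=
  finitePresentation_X₃ (shortExact_syzygySequence P n)

include P in
lemma finitePresentation_of_resolution : Module.FinitePresentation R C :=
  .of_equiv (opcyclesZeroIso P).toLinearEquiv

lemma extOrthogonal_syzygy_tensor (hC : IsSemidualizing R C) (n : ℕ) (Q : Type u)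
    [AddCommGroup Q] [Module R Q] [Module.Projective R Q] :
    extOrthogonal (cFlatModules R C) (ModuleCat.of R (P.complex.opcycles n ⊗[R] Q)) := by
  refine extOrthogonal_of_syzygies (· + 1) _
    (fun n => shortExact_rTensor (shortExact_syzygySequence P n) Q) (fun n => Iso.refl _)
    (fun n => isProjective_le_extOrthogonal _
      (inferInstanceAs (Projective (ModuleCat.of R (P.complex.X n ⊗[R] Q))))) ?_ n
  rintro n H ⟨F, hF, ⟨e⟩⟩
  exact comp_left_surjective_iff_lcomp.2 (lcomp_rTensor_surjective (lcomp_surjective_congr e.symm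
    (lcomp_surjective_tensor (lcomp_fromOpcycles_surjective P hC n))))

lemma cProjectiveModules_le_extOrthogonal (hC : IsSemidualizing R C) :
    cProjectiveModules R C ≤ extOrthogonal (cFlatModules R C) := by
  obtain ⟨P, hP⟩ := hC.exists_finite_resolution
  rintro M ⟨Q, hQ, ⟨e⟩⟩
  exact ObjectProperty.prop_of_iso _
    ((opcyclesZeroIso P).toLinearEquiv.rTensor Q ≪≫ₗ e.symm).toModuleIso
    (extOrthogonal_syzygy_tensor P hC 0 Q)

lemma tensorBidual_syzygy_bijective (hC : IsSemidualizing R C) (n : ℕ) (F : Type u)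
    [AddCommGroup F] [Module R F] [Module.Flat R F] :
    Function.Bijective (tensorBidual R (P.complex.opcycles n) F C) := by
  have := finitePresentation_of_resolution P
  induction n with
  | zero =>
    let e := (opcyclesZeroIso P).toLinearEquiv
    exact tensorBidual_bijective_of_sum_comp_eq_id {()} (fun _ => e.toLinearMap)
      (fun _ => e.symm.toLinearMap) (by simp) (tensorBidual_self_bijective hC.homothety_bijective)
  | succ n ih =>
    have hS := shortExact_syzygySequence P n
    exact tensorBidual_bijective_of_exact hS.moduleCat_injective_f
      (function_exact_of_shortExact hS) hS.moduleCat_surjective_g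
      (lcomp_fromOpcycles_surjective P hC n) ih.1
      (tensorBidual_bijective_of_projective hC.homothety_bijective)

lemma extOrthogonal_dual_syzygy_tensor (hC : IsSemidualizing R C) (n : ℕ) (Q : ModuleCat.{u} R)
    [hQ : Module.Projective R Q] :
    extOrthogonal (cFlatModules R C)
      (ModuleCat.of R ((P.complex.opcycles n →ₗ[R] C) ⊗[R] Q)) := by
  induction n with
  | zero =>
    exact ObjectProperty.prop_of_iso _ (homTensorIso P hC Q).symm
      (isProjective_le_extOrthogonal _ ((IsProjective.iff_projective _).1 hQ))
  | succ n ih =>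
    refine extOrthogonal_X₃ (shortExact_dual_syzygy_tensor P hC n Q) ih
      (cProjectiveModules_le_extOrthogonal hC _
        (cProjectiveModules_hom_tensor (P.complex.X n) Q)) ?_
    rintro H ⟨F, hF, ⟨e⟩⟩
    exact comp_left_surjective_iff_lcomp.2 (lcomp_rTensor_surjective
      (lcomp_surjective_congr e.symm (lcomp_lcomp_surjective
        (shortExact_syzygySequence P n).moduleCat_surjective_g
        (tensorBidual_syzygy_bijective P hC n F).2)))

lemma projectiveModules_le_properlyCoresolved (hC : IsSemidualizing R C) :
    projectiveModules R ≤ properlyCoresolved (cProjectiveModules R C) (cFlatModules R C) := by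
  obtain ⟨P, hP⟩ := hC.exists_finite_resolution
  intro Q (hQ : Module.Projective R Q)
  refine ObjectProperty.prop_of_iso _ (homTensorIso P hC Q)
    ⟨fun W => ∃ n, ModuleCat.of R ((P.complex.opcycles n →ₗ[R] C) ⊗[R] Q) = W, ?_, ?_, 0, rfl⟩
  · rintro _ ⟨n, rfl⟩
    exact extOrthogonal_dual_syzygy_tensor P hC n Q
  · rintro _ ⟨n, rfl⟩
    exact ⟨_, ⟨n + 1, rfl⟩, _, _, _, _, shortExact_dual_syzygy_tensor P hC n Q,
      cProjectiveModules_hom_tensor (P.complex.X n) Q⟩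

end Semidualizing

theorem corollary2p10 (R : Type u) [CommRing R] (C : Type u) [AddCommGroup C] [Module R C]
    (hC : IsSemidualizing R C) :
    IsProjectivelyResolving (dcProjectiveComplexes R C) ∧
      ∀ X : ChainComplex (ModuleCat.{u} R) ℤ,
        complexesOf (projectiveModules R) X → dcProjectiveComplexes R C X := by
  have resolving : IsProjectivelyResolving (dcProjectiveComplexes R C) := by
    change IsProjectivelyResolving (completelyResolved _ _ _)
    rw [complexesOf_eq_splicedComplexes, complexesOf_eq_splicedComplexes,
      complexesOf_eq_splicedComplexes, projectiveModules_eq_isProjective]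
    exact isProjectivelyResolving_spliced (cProjectiveModules_le_extOrthogonal hC)
      cProjectiveModules_le_cFlatModules (fun _ _ => cProjectiveModules_biprod)
      (projectiveModules_eq_isProjective.ge.trans (projectiveModules_le_properlyCoresolved hC))
  refine ⟨resolving, fun X hX => resolving.1 X ?_⟩
  rwa [complexesOf_eq_splicedComplexes, projectiveModules_eq_isProjective,
    splicedComplexes_isProjective] at hX
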